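/- For positive integers $t \le s$ and an $s \times s$ $0$-$1$ matrix $M$ (a matrix over $\mathbb{F}_2$), let $N_t(M)$ be the number of $t \times t$ submatrices of $M$ (choices of $t$ columns and $t$ rows) that are invertible over $\mathbb{F}_2$, let $R_t(M) = N_t(M)/\binom{s}{t}^2$, and let $$R_t(s) = \max\{R_t(M) : M \text{ is an } s \times s \ 0\text{-}1 \text{ matrix that is invertible over } \mathbb{F}_2\}.$$ Then for every integer $s \ge 4$, $$R_2(s) \le \frac{5s}{8(s-1)}.$$ This upper bound tends to $5/8$ as $s \to \infty$; consequently $\limsup_{s\to\infty} R_2(s) \le 5/8$. -/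

import Mathlib

namespace AONT

/-- The `t`-element subsets of `{1, …, s}`. -/
abbrev IndexSubset (s t : ℕ) : Type := {I : Finset (Fin s) // I.card = t}

/-- The `t × t` submatrix `M(I, J)` of `M` with columns in `I` and rows in `J`
(both kept in increasing order). A 0-1 matrix is a matrix over `𝔽₂ = ZMod 2`. -/
def subMat {s t : ℕ} (M : Matrix (Fin s) (Fin s) (ZMod 2)) (I J : IndexSubset s t) :
    Matrix (Fin t) (Fin t) (ZMod 2) :=
  M.submatrix (J.1.orderEmbOfFin J.2) (I.1.orderEmbOfFin I.2)

open Classical in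
/-- `N_t(M)`: the number of `t × t` submatrices of `M` that are invertible over `𝔽₂`. -/
noncomputable def numInvertible {s : ℕ} (t : ℕ) (M : Matrix (Fin s) (Fin s) (ZMod 2)) : ℕ :=
  (Finset.univ.filter
    (fun p : IndexSubset s t × IndexSubset s t => IsUnit (subMat M p.1 p.2))).card

/-- The `t`-density `R_t(M) = N_t(M) / (s choose t)²`. -/
noncomputable def density {s : ℕ} (t : ℕ) (M : Matrix (Fin s) (Fin s) (ZMod 2)) : ℝ :=
  (numInvertible t M : ℝ) / (s.choose t : ℝ) ^ 2

/-- `R_t(s)`: the maximum `t`-density of an `s × s` matrix that is invertible over `𝔽₂`. -/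
noncomputable def maxDensity (t s : ℕ) : ℝ :=
  sSup {r : ℝ | ∃ M : Matrix (Fin s) (Fin s) (ZMod 2), IsUnit M ∧ r = density t M}

/-- The supremum in `maxDensity` is an attained maximum. -/
theorem isGreatest_maxDensity (t s : ℕ) :
    IsGreatest {r : ℝ | ∃ M : Matrix (Fin s) (Fin s) (ZMod 2), IsUnit M ∧ r = density t M}
      (maxDensity t s) := by
  have hfin : {r : ℝ | ∃ M : Matrix (Fin s) (Fin s) (ZMod 2),
      IsUnit M ∧ r = density t M}.Finite := by
    refine (Set.finite_range
      (fun M : Matrix (Fin s) (Fin s) (ZMod 2) => density t M)).subset ?_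
    rintro r ⟨M, -, rfl⟩
    exact ⟨M, rfl⟩
  exact ⟨Set.Nonempty.csSup_mem ⟨_, 1, isUnit_one, rfl⟩ hfin,
    fun r hr => le_csSup hfin.bddAbove hr⟩

end AONT


/-! Over `𝔽₂` the rows of `M` are the indicators of sets `Sᵢ` of columns, and the number of nonzero
`2 × 2` minors in rows `i`, `j` is `|Sᵢ| |Sⱼ| - |Sᵢ ∩ Sⱼ|²`. By Cauchy–Schwarz, the sum of these
numbers is bounded in terms of `T = ∑ i, |Sᵢ| = ∑ c, d c` and
`Q = ∑ i ≠ j, |Sᵢ ∩ Sⱼ| = ∑ c, d c * (d c - 1)`, where `d c` is the number of ones in column `c`: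
for `m` rows, the bound is a positive multiple of `((m - 1) * T) ^ 2 - Q ^ 2`. Since `d c` is an
integer, `d c * (d c - 1)` lies above two suitable lines, so `Q` has two lower bounds that are
linear in `T`. The resulting bound is largest where these agree, which is when three quarters of
the entries of `M` are ones. -/

namespace AONT

open Finset Filter Topology
open scoped Nat

theorem sq_sum_diag_add_sq_sum_offDiag_le {ι : Type*} [Fintype ι] (f : ι → ι → ℝ) :
    (Fintype.card ι - 1) * (∑ i, f i i) ^ 2 + (∑ i, ∑ j, f i j - ∑ i, f i i) ^ 2 ≤
      Fintype.card ι * (Fintype.card ι - 1) * ∑ i, ∑ j, f i j ^ 2 := by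
  classical
  rcases isEmpty_or_nonempty ι with _ | _
  · simp
  have hcard : (1 : ℝ) ≤ Fintype.card ι := by exact_mod_cast Fintype.card_pos (α := ι)
  have sum_eq_diag_add_offDiag (g : ι → ι → ℝ) :
      ∑ i, ∑ j, g i j = ∑ i, g i i + ∑ p ∈ (univ : Finset ι).offDiag, g p.1 p.2 := by
    rw [← Fintype.sum_prod_type', ← univ_product_univ, ← diag_union_offDiag,
      sum_union (disjoint_diag_offDiag _), sum_diag]
  have hdiag : (∑ i, f i i) ^ 2 ≤ Fintype.card ι * ∑ i, f i i ^ 2 := sq_sum_le_card_mul_sum_sq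
  have hoffDiag : (∑ p ∈ (univ : Finset ι).offDiag, f p.1 p.2) ^ 2 ≤
      Fintype.card ι * (Fintype.card ι - 1) *
        ∑ p ∈ (univ : Finset ι).offDiag, f p.1 p.2 ^ 2 := by
    refine sq_sum_le_card_mul_sum_sq.trans_eq ?_
    rw [offDiag_card, card_univ, Nat.cast_sub (Nat.le_mul_self _)]
    push_cast
    ring
  rw [sum_eq_diag_add_offDiag f, sum_eq_diag_add_offDiag fun i j => f i j ^ 2, add_sub_cancel_left]
  linarith [mul_le_mul_of_nonneg_left hdiag (sub_nonneg.mpr hcard)]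

theorem int_mul_sub_one_nonneg (a : ℤ) : 0 ≤ a * (a - 1) := by
  rcases le_or_gt a 0 with h | h
  · exact mul_nonneg_of_nonpos_of_nonpos h (by linarith)
  · exact mul_nonneg h.le (by linarith)

theorem steep_linear_le_mul_sub_one (m k : ℤ) : (m - 1) * (2 * k - m) ≤ k * (k - 1) := by
  linarith [int_mul_sub_one_nonneg (m - k)]

-- In a column with `k` ones among `m` entries, let `j` be the number of ones among four entries
-- chosen uniformly. Then `6 * k * (k - 1) / (m * (m - 1))` is the mean of `j.choose 2`, hence at
-- least the mean of `2 * j - 3`.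
theorem shallow_linear_le_mul_sub_one {m : ℤ} (hm : 4 ≤ m) (k : ℤ) :
    (m - 1) * (8 * k - 3 * m) ≤ 6 * (k * (k - 1)) := by
  obtain rfl | rfl | hm : m = 4 ∨ m = 5 ∨ 6 ≤ m := by omega
  · linarith [int_mul_sub_one_nonneg (k - 2)]
  · rcases le_or_gt k 3 with h | h <;> nlinarith
  · nlinarith [sq_nonneg (6 * k - 4 * m + 1)]

theorem sixteen_mul_sq_sub_sq_le {K : Type*} [CommRing K] [LinearOrder K] [IsStrictOrderedRing K]
    {x y z : K} (hx : 0 ≤ x) (hshallow : 8 * x - 3 * z ≤ 6 * y) (hsteep : 2 * x - z ≤ y) :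
    16 * (x ^ 2 - y ^ 2) ≤ 5 * z ^ 2 := by
  rcases le_total (8 * x) (3 * z) with hxz | hzx
  · nlinarith
  rcases le_total (4 * x) (3 * z) with hxz' | hzx'
  · have hsq : (8 * x - 3 * z) ^ 2 ≤ (6 * y) ^ 2 := pow_le_pow_left₀ (by linarith) hshallow 2
    nlinarith [mul_nonneg (sub_nonneg.mpr hxz') (by linarith : 0 ≤ 27 * z - 28 * x)]
  · have hsq : (2 * x - z) ^ 2 ≤ y ^ 2 := pow_le_pow_left₀ (by linarith) hsteep 2
    nlinarith [mul_nonneg (sub_nonneg.mpr hzx') (by linarith : 0 ≤ 12 * x - 7 * z)]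

section SetFamily

variable {ι α : Type*} [Fintype ι] [DecidableEq α]

/-- The degree of a point in an indexed set family: the number of members containing it. For the
family of row supports of a 0-1 matrix it is the number of ones in a column. -/
def degree (S : ι → Finset α) (a : α) : ℕ := #{i | a ∈ S i}

theorem sum_card_eq_sum_degree [Fintype α] (S : ι → Finset α) :
    ∑ i, #(S i) = ∑ a, degree S a := by
  simpa [bipartiteAbove, bipartiteBelow, degree] using
    sum_card_bipartiteAbove_eq_sum_card_bipartiteBelow (s := univ) (t := univ)
      (fun i a => a ∈ S i)

theorem sum_card_inter_eq_sum_degree_sq [Fintype α] (S : ι → Finset α) :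
    ∑ i, ∑ j, #(S i ∩ S j) = ∑ a, degree S a ^ 2 := by
  have hdegree (a : α) : degree (fun p : ι × ι => S p.1 ∩ S p.2) a = degree S a ^ 2 := by
    rw [degree, degree, sq, ← card_product, ← filter_product, univ_product_univ]
    simp only [mem_inter]
  simp only [← hdegree, ← sum_card_eq_sum_degree, Fintype.sum_prod_type]

theorem linear_le_sum_card_inter_sub_sum_card [Fintype α] (S : ι → Finset α) {a b c : ℝ}
    (h : ∀ k : ℕ, a * k - b ≤ c * (k * (k - 1))) :
    a * ∑ i, (#(S i) : ℝ) - b * Fintype.card α ≤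
      c * (∑ i, ∑ j, (#(S i ∩ S j) : ℝ) - ∑ i, (#(S i) : ℝ)) := by
  have hcard : ∑ i, (#(S i) : ℝ) = ∑ x, (degree S x : ℝ) := by
    exact_mod_cast sum_card_eq_sum_degree S
  have hinter : ∑ i, ∑ j, (#(S i ∩ S j) : ℝ) = ∑ x, (degree S x : ℝ) ^ 2 := by
    exact_mod_cast sum_card_inter_eq_sum_degree_sq S
  calc a * ∑ i, (#(S i) : ℝ) - b * Fintype.card α
      = ∑ x, (a * degree S x - b) := by
        rw [hcard, sum_sub_distrib, mul_sum, sum_const, card_univ, nsmul_eq_mul, mul_comm b]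
    _ ≤ ∑ x, c * (degree S x * (degree S x - 1)) := sum_le_sum fun x _ => h (degree S x)
    _ = c * (∑ i, ∑ j, (#(S i ∩ S j) : ℝ) - ∑ i, (#(S i) : ℝ)) := by
        rw [hcard, hinter, ← sum_sub_distrib, mul_sum]
        exact sum_congr rfl fun x _ => by ring

theorem sixteen_mul_sq_sum_card_sub_le [Fintype α] (hι : 4 ≤ Fintype.card ι) (S : ι → Finset α) :
    16 * ((∑ i, (#(S i) : ℝ)) ^ 2 - ∑ i, ∑ j, (#(S i ∩ S j) : ℝ) ^ 2) ≤
      5 * (Fintype.card ι * (Fintype.card ι - 1)) * (Fintype.card α : ℝ) ^ 2 := by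
  have hm4 : (4 : ℝ) ≤ Fintype.card ι := by exact_mod_cast hι
  have hshallowLine (k : ℕ) : ((Fintype.card ι : ℝ) - 1) * (8 * k - 3 * Fintype.card ι) ≤
      6 * (k * (k - 1)) := by
    exact_mod_cast shallow_linear_le_mul_sub_one (m := Fintype.card ι) (by exact_mod_cast hι) k
  have hsteepLine (k : ℕ) : ((Fintype.card ι : ℝ) - 1) * (2 * k - Fintype.card ι) ≤
      k * (k - 1) := by
    exact_mod_cast steep_linear_le_mul_sub_one (Fintype.card ι) k
  set m : ℝ := (Fintype.card ι : ℝ)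
  set n : ℝ := (Fintype.card α : ℝ)
  set T : ℝ := ∑ i, (#(S i) : ℝ)
  set Q : ℝ := ∑ i, ∑ j, (#(S i ∩ S j) : ℝ) - T
  have hm1 : 0 < m - 1 := by linarith
  have hT : 0 ≤ T := sum_nonneg fun i _ => Nat.cast_nonneg _
  have hshallow : (m - 1) * 8 * T - (m - 1) * (3 * m) * n ≤ 6 * Q :=
    linear_le_sum_card_inter_sub_sum_card S fun k => by linarith [hshallowLine k]
  have hsteep : (m - 1) * 2 * T - (m - 1) * m * n ≤ 1 * Q :=
    linear_le_sum_card_inter_sub_sum_card S fun k => by linarith [hsteepLine k]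
  have hcauchy : (m - 1) * T ^ 2 + Q ^ 2 ≤ m * (m - 1) * ∑ i, ∑ j, (#(S i ∩ S j) : ℝ) ^ 2 := by
    simpa only [inter_self] using sq_sum_diag_add_sq_sum_offDiag_le fun i j => (#(S i ∩ S j) : ℝ)
  have hquad : 16 * (((m - 1) * T) ^ 2 - Q ^ 2) ≤ 5 * ((m - 1) * m * n) ^ 2 :=
    sixteen_mul_sq_sub_sq_le (mul_nonneg hm1.le hT) (by linarith) (by linarith)
  refine le_of_mul_le_mul_left ?_ (mul_pos (by linarith : 0 < m) hm1)
  linarith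

end SetFamily

section Minors

variable {m n : Type*}

/-- The support of row `i` of a matrix over `𝔽₂`, as a set of column indices; it determines the
row. -/
def rowSupport [Fintype n] (M : Matrix m n (ZMod 2)) (i : m) : Finset n := {c | M i c ≠ 0}

theorem det_submatrix_ne_zero_iff [Fintype n] [DecidableEq n] (M : Matrix m n (ZMod 2))
    (r : Fin 2 → m) (c : Fin 2 → n) :
    (M.submatrix r c).det ≠ 0 ↔
      (c 0, c 1) ∈ symmDiff (rowSupport M (r 0) ×ˢ rowSupport M (r 1))
        (rowSupport M (r 1) ×ˢ rowSupport M (r 0)) := by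
  have hdet : ∀ a b c d : ZMod 2, a * d - b * c ≠ 0 ↔
      ((a ≠ 0 ∧ d ≠ 0) ∧ ¬(c ≠ 0 ∧ b ≠ 0)) ∨ ((c ≠ 0 ∧ b ≠ 0) ∧ ¬(a ≠ 0 ∧ d ≠ 0)) := by decide
  simp only [Matrix.det_fin_two, Matrix.submatrix_apply, mem_symmDiff, mem_product, rowSupport,
    mem_filter, mem_univ, true_and, hdet]

theorem card_symmDiff_product_swap {α : Type*} [DecidableEq α] (A B : Finset α) :
    #(symmDiff (A ×ˢ B) (B ×ˢ A)) + 2 * #(A ∩ B) ^ 2 = 2 * (#A * #B) := by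
  have hinter : #((A ×ˢ B) ∩ (B ×ˢ A)) = #(A ∩ B) ^ 2 := by
    rw [product_inter_product, inter_comm B A, card_product, sq]
  have hleft := card_sdiff_add_card_inter (A ×ˢ B) (B ×ˢ A)
  have hright := card_sdiff_add_card_inter (B ×ˢ A) (A ×ˢ B)
  rw [inter_comm, hinter, card_product] at hright
  rw [hinter, card_product] at hleft
  rw [symmDiff_def, sup_eq_union, card_union_of_disjoint disjoint_sdiff_sdiff]
  linarith

/-- The nonzero `t × t` minors of `M`, indexed by ordered lists of `t` rows and of `t` columns.
Lists with repetitions are allowed, since they give zero minors; thus each choice of a row set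
and a column set is counted `t ! ^ 2` times. -/
def nonzeroMinors [Fintype m] [Fintype n] (t : ℕ) (M : Matrix m n (ZMod 2)) :
    Finset ((Fin t → m) × (Fin t → n)) :=
  {p | (M.submatrix p.1 p.2).det ≠ 0}

theorem card_nonzeroMinors_of_rows [Fintype n] [DecidableEq n] (M : Matrix m n (ZMod 2))
    (r : Fin 2 → m) :
    #{c : Fin 2 → n | (M.submatrix r c).det ≠ 0} +
        2 * #(rowSupport M (r 0) ∩ rowSupport M (r 1)) ^ 2 =
      2 * (#(rowSupport M (r 0)) * #(rowSupport M (r 1))) := by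
  rw [← card_symmDiff_product_swap, ← Fintype.card_coe (symmDiff _ _), ← Fintype.card_subtype]
  congr 1
  exact Fintype.card_congr
    ((finTwoArrowEquiv n).subtypeEquiv fun c => det_submatrix_ne_zero_iff M r c)

theorem card_nonzeroMinors_two [Fintype m] [Fintype n] [DecidableEq n]
    (M : Matrix m n (ZMod 2)) :
    #(nonzeroMinors 2 M) + 2 * ∑ i, ∑ j, #(rowSupport M i ∩ rowSupport M j) ^ 2 =
      2 * (∑ i, #(rowSupport M i)) ^ 2 := by
  have hcard : #(nonzeroMinors 2 M) =
      ∑ r : Fin 2 → m, #{c : Fin 2 → n | (M.submatrix r c).det ≠ 0} := by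
    simp only [nonzeroMinors, card_filter, Fintype.sum_prod_type]
  have sum_rows (f : m → m → ℕ) : ∑ r : Fin 2 → m, f (r 0) (r 1) = ∑ i, ∑ j, f i j :=
    (Equiv.sum_comp (finTwoArrowEquiv m) fun p => f p.1 p.2).trans (Fintype.sum_prod_type _)
  rw [hcard, sq (∑ i, _), sum_mul_sum, ← sum_rows fun i j => #(_ ∩ _) ^ 2,
    ← sum_rows fun i j => #(rowSupport M i) * #(rowSupport M j), mul_sum, mul_sum,
    ← sum_add_distrib]
  exact sum_congr rfl fun r _ => card_nonzeroMinors_of_rows M r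

theorem eight_mul_card_nonzeroMinors_two_le [Fintype m] [Fintype n] (hm : 4 ≤ Fintype.card m)
    (M : Matrix m n (ZMod 2)) :
    8 * (#(nonzeroMinors 2 M) : ℝ) ≤
      5 * (Fintype.card m * (Fintype.card m - 1)) * (Fintype.card n : ℝ) ^ 2 := by
  classical
  have hcard : (#(nonzeroMinors 2 M) : ℝ) +
        2 * ∑ i, ∑ j, (#(rowSupport M i ∩ rowSupport M j) : ℝ) ^ 2 =
      2 * (∑ i, (#(rowSupport M i) : ℝ)) ^ 2 := by
    exact_mod_cast card_nonzeroMinors_two M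
  linarith [sixteen_mul_sq_sum_card_sub_le hm (rowSupport M)]

end Minors

theorem orderEmbOfFin_comp_perm_injective (s t : ℕ) :
    Function.Injective fun p : IndexSubset s t × Equiv.Perm (Fin t) =>
      p.1.1.orderEmbOfFin p.1.2 ∘ p.2 := by
  rintro ⟨I, σ⟩ ⟨J, τ⟩ h
  have hrange : Set.range (I.1.orderEmbOfFin I.2) = Set.range (J.1.orderEmbOfFin J.2) := by
    simpa [EquivLike.range_comp] using congrArg Set.range h
  obtain rfl : I = J := Subtype.ext (by simpa using hrange)
  exact Prod.ext rfl (DFunLike.coe_injective ((I.1.orderEmbOfFin I.2).injective.comp_left h))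

theorem factorial_sq_mul_numInvertible_le {s : ℕ} (t : ℕ) (M : Matrix (Fin s) (Fin s) (ZMod 2)) :
    t ! ^ 2 * numInvertible t M ≤ #(nonzeroMinors t M) := by
  classical
  let arrange (p : IndexSubset s t × Equiv.Perm (Fin t)) : Fin t → Fin s :=
    p.1.1.orderEmbOfFin p.1.2 ∘ p.2
  let invertible : Finset (IndexSubset s t × IndexSubset s t) := {p | IsUnit (subMat M p.1 p.2)}
  let perms : Finset (Equiv.Perm (Fin t) × Equiv.Perm (Fin t)) := univ
  have hcard : t ! ^ 2 * numInvertible t M = #(invertible ×ˢ perms) := by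
    rw [card_product, mul_comm]
    simp [invertible, perms, numInvertible, Fintype.card_perm, sq]
  rw [hcard]
  refine card_le_card_of_injOn
    (fun q => (arrange (q.1.2, q.2.1), arrange (q.1.1, q.2.2))) ?_ ?_
  · rintro ⟨⟨I, J⟩, σ, τ⟩ hq
    have hunit : IsUnit (subMat M I J) := by simpa [invertible, perms] using hq
    rw [← Matrix.isUnit_submatrix_equiv (e₁ := σ) (e₂ := τ), Matrix.isUnit_iff_isUnit_det,
      isUnit_iff_ne_zero] at hunit
    simpa [nonzeroMinors, arrange, subMat] using hunit
  · rintro ⟨⟨I, J⟩, σ, τ⟩ - ⟨⟨I', J'⟩, σ', τ'⟩ - h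
    obtain ⟨hrow, hcol⟩ := Prod.mk.inj h
    obtain ⟨rfl, rfl⟩ := Prod.mk.inj (orderEmbOfFin_comp_perm_injective s t hrow)
    obtain ⟨rfl, rfl⟩ := Prod.mk.inj (orderEmbOfFin_comp_perm_injective s t hcol)
    rfl

theorem density_two_le {s : ℕ} (hs : 4 ≤ s) (M : Matrix (Fin s) (Fin s) (ZMod 2)) :
    density 2 M ≤ 5 * (s : ℝ) / (8 * ((s : ℝ) - 1)) := by
  have hs4 : (4 : ℝ) ≤ s := by exact_mod_cast hs
  have hs1 : (0 : ℝ) < s - 1 := by linarith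
  have hcount : 4 * (numInvertible 2 M : ℝ) ≤ #(nonzeroMinors 2 M) := by
    exact_mod_cast factorial_sq_mul_numInvertible_le 2 M
  have hminors : 8 * (#(nonzeroMinors 2 M) : ℝ) ≤ 5 * (s * (s - 1)) * (s : ℝ) ^ 2 := by
    simpa only [Fintype.card_fin] using eight_mul_card_nonzeroMinors_two_le (by simpa using hs) M
  have hnum : 32 * (numInvertible 2 M : ℝ) ≤ 5 * (s * (s - 1)) * (s : ℝ) ^ 2 := by linarith
  rw [density, Nat.cast_choose_two, div_le_div_iff₀ (by positivity) (by positivity)]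
  linarith [mul_le_mul_of_nonneg_right hnum hs1.le]

theorem tendsto_density_bound :
    Tendsto (fun s : ℕ => 5 * (s : ℝ) / (8 * ((s : ℝ) - 1))) atTop (𝓝 (5 / 8)) := by
  have hratio : Tendsto (fun s : ℕ => (5 / 8 : ℝ) * (s / (s + -1))) atTop (𝓝 (5 / 8 * 1)) :=
    (tendsto_natCast_div_add_atTop (-1)).const_mul _
  simpa only [mul_one, div_mul_div_comm, ← sub_eq_add_neg] using hratio

end AONT

theorem mainTheorem6_general :
    (∀ s : ℕ, 4 ≤ s → ∀ M : Matrix (Fin s) (Fin s) (ZMod 2),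
      AONT.density 2 M ≤ 5 * (s : ℝ) / (8 * ((s : ℝ) - 1))) ∧
    Filter.Tendsto (fun s : ℕ => 5 * (s : ℝ) / (8 * ((s : ℝ) - 1))) Filter.atTop
      (nhds (5 / 8)) ∧
    Filter.limsup (fun s : ℕ => ⨆ M : Matrix (Fin s) (Fin s) (ZMod 2),
      ((AONT.density 2 M : ℝ) : EReal)) Filter.atTop ≤ ((5 / 8 : ℝ) : EReal) := by
  refine ⟨fun s => AONT.density_two_le, AONT.tendsto_density_bound, ?_⟩
  have hlim := (continuous_coe_real_ereal.tendsto _).comp AONT.tendsto_density_bound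
  refine (Filter.limsup_le_limsup ?_).trans_eq hlim.limsup_eq
  filter_upwards [Filter.eventually_ge_atTop 4] with s hs
  exact iSup_le fun M => EReal.coe_le_coe_iff.mpr (AONT.density_two_le hs M)

theorem mainTheorem6 :
    (∀ s : ℕ, 4 ≤ s → AONT.maxDensity 2 s ≤ 5 * (s : ℝ) / (8 * ((s : ℝ) - 1))) ∧
    Filter.Tendsto (fun s : ℕ => 5 * (s : ℝ) / (8 * ((s : ℝ) - 1))) Filter.atTop
      (nhds (5 / 8)) ∧
    Filter.limsup (fun s : ℕ => ((AONT.maxDensity 2 s : ℝ) : EReal)) Filter.atTop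
      ≤ ((5 / 8 : ℝ) : EReal) := by
  obtain ⟨hdensity, htendsto, hlimsup⟩ := mainTheorem6_general
  choose M _ hM using fun s => (AONT.isGreatest_maxDensity 2 s).1
  simp only [hM]
  exact ⟨fun s hs => hdensity s hs (M s), htendsto, (Filter.limsup_le_limsup
    (.of_forall fun s => le_iSup (fun M => ((AONT.density 2 M : ℝ) : EReal)) (M s))).trans hlimsup⟩
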